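/- Let $T$ be a first-order theory in a countable language $L$, and let $\mathcal U\models T$ be a monster model, i.e. $\mathcal U$ is $\bar\kappa$-saturated and strongly $\bar\kappa$-homogeneous for some uncountable cardinal $\bar\kappa$. Let $M\prec\mathcal U$ be a countable elementary submodel. Let $\phi(x;y)$ be an $L$-formula, where $x,y$ are finite tuples of variables, and assume that $\phi$ is NIP: there do not exist an infinite set $A$ of $|x|$-tuples of $\mathcal U$ and $|y|$-tuples $b_I$ of $\mathcal U$, for $I\subseteq A$, such that $\mathcal U\models\phi(a;b_I)\iff a\in I$ for all $a\in A$ and $I\subseteq A$. Let $S_\phi(\mathcal U)$ be the space of global $\phi$-types, i.e. of maximal consistent sets of formulas of the form $\phi(x;b)$ or $\neg\phi(x;b)$ with $b\in\mathcal U^{|y|}$, with the topology generated by the sets $\{p:\phi(x;b)\in p\}$ and $\{p:\neg\phi(x;b)\in p\}$. Let $\mathrm{Inv}_\phi(M)\subseteq S_\phi(\mathcal U)$ be the set of $M$-invariant types, i.e. those invariant under all automorphisms of $\mathcal U$ fixing $M$ pointwise. Let $Z\subseteq \mathrm{Inv}_\phi(M)$ be any subset and let $p\in\overline Z$, the closure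 of $Z$ in $S_\phi(\mathcal U)$. Then there is a sequence $(q_n)_{n<\omega}$ of elements of $Z$ that converges to $p$ in $S_\phi(\mathcal U)$. -/

import Mathlib

open FirstOrder Cardinal Topology

universe u v w

namespace LocalTypes

variable {L : FirstOrder.Language.{u, v}} {n m : ℕ}

section Monster

variable (L) (U : Type w) [L.Structure U]

/-- `U` is `κ`-saturated: every set of formulas in finitely many variables, with parameters from a
set `A ⊆ U` with `|A| < κ`, that is finitely satisfiable in `U` is realised in `U`. -/
def IsSaturated (κ : Cardinal.{w}) : Prop :=
  ∀ A : Set U, #A < κ → ∀ (k : ℕ) (Γ : Set (L[[A]].Formula (Fin k))),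
    (∀ s : Finset (L[[A]].Formula (Fin k)), (s : Set (L[[A]].Formula (Fin k))) ⊆ Γ →
      ∃ a : Fin k → U, ∀ ψ ∈ s, ψ.Realize a) →
    ∃ a : Fin k → U, ∀ ψ ∈ Γ, ψ.Realize a

/-- `U` is strongly `κ`-homogeneous: every elementary map `f : A → U` with `A ⊆ U`, `|A| < κ`
extends to an automorphism of `U`. A formula whose free variables are indexed by `A` is evaluated
at the inclusion `A → U` and at `f`. -/
def IsStronglyHomogeneous (κ : Cardinal.{w}) : Prop :=
  ∀ A : Set U, #A < κ → ∀ f : A → U,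
    (∀ ψ : L.Formula A, ψ.Realize (fun a : A => (a : U)) ↔ ψ.Realize f) →
    ∃ σ : U ≃[L] U, ∀ a : A, σ a = f a

/-- `U` is a monster model (with respect to the cardinal `κ`): it is `κ`-saturated and strongly
`κ`-homogeneous. -/
structure IsMonster (κ : Cardinal.{w}) : Prop where
  saturated : IsSaturated L U κ
  homogeneous : IsStronglyHomogeneous L U κ

end Monster

/-- The formula `φ(x;y)`, `x = (x₀,…,x_{n-1})`, `y = (y₀,…,y_{m-1})`, is NIP in `U`: there are no
infinite set `A` of `n`-tuples and `m`-tuples `b I`, `I ⊆ A`, such that for all `a ∈ A`,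
`U ⊨ φ(a; b I)` iff `a ∈ I`. -/
def IsNIP (U : Type w) [L.Structure U] (φ : L.Formula (Fin n ⊕ Fin m)) : Prop :=
  ¬ ∃ A : Set (Fin n → U), A.Infinite ∧ ∃ b : Set (Fin n → U) → (Fin m → U),
    ∀ I ⊆ A, ∀ a ∈ A, (φ.Realize (Sum.elim a (b I)) ↔ a ∈ I)

section Types

variable {U : Type w} [L.Structure U]

/-- The formula `φ(x;b)` in the variables `x`, with parameters `b` from `U`. -/
def inst (φ : L.Formula (Fin n ⊕ Fin m)) (b : Fin m → U) : L[[U]].Formula (Fin n) :=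
  ((L.lhomWithConstants U).onFormula φ).subst
    (Sum.elim (fun i => Language.Term.var i) (fun j => (L.con (b j)).term))

@[simp]
theorem realize_inst (φ : L.Formula (Fin n ⊕ Fin m)) (b : Fin m → U) (a : Fin n → U) :
    (inst φ b).Realize a ↔ φ.Realize (Sum.elim a b) := by
  unfold inst Language.Formula.Realize
  rw [Language.BoundedFormula.realize_subst]
  have h : (fun i : Fin n ⊕ Fin m => Language.Term.realize a
      ((Sum.elim (fun i => Language.Term.var i)
        (fun j => (L.con (b j)).term) : Fin n ⊕ Fin m → L[[U]].Term (Fin n)) i))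
      = Sum.elim a b := by
    funext i
    cases i with
    | inl i => simp
    | inr j => exact (Language.Term.realize_constants).trans rfl
  rw [h]
  exact Language.LHom.realize_onFormula _ φ

/-- A global (complete) `φ`-type: a consistent set of formulas of the form `φ(x;b)` and
`¬φ(x;b)`, `b` in `U`, that for every `b` contains one of the two. Consistency (with the elementary
diagram of `U`) is finite satisfiability in `U`. -/
@[ext]
structure GlobalType (U : Type w) [L.Structure U] (φ : L.Formula (Fin n ⊕ Fin m)) where
  /-- the formulas in the type -/
  carrier : Set (L[[U]].Formula (Fin n))
  isInstance : ∀ ψ ∈ carrier, ∃ b : Fin m → U, ψ = inst φ b ∨ ψ = (inst φ b).not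
  consistent : ∀ s : Finset (L[[U]].Formula (Fin n)),
    (s : Set (L[[U]].Formula (Fin n))) ⊆ carrier → ∃ a : Fin n → U, ∀ ψ ∈ s, ψ.Realize a
  complete : ∀ b : Fin m → U, inst φ b ∈ carrier ∨ (inst φ b).not ∈ carrier

/-- The topology of the space of global `φ`-types, generated by the sets
`{p | φ(x;b) ∈ p}` and `{p | ¬φ(x;b) ∈ p}`. -/
instance (φ : L.Formula (Fin n ⊕ Fin m)) : TopologicalSpace (GlobalType U φ) :=
  TopologicalSpace.generateFrom
    {S | ∃ b : Fin m → U, S = {p | inst φ b ∈ p.carrier} ∨ S = {p | (inst φ b).not ∈ p.carrier}}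

/-- The set of global `φ`-types that are `M`-invariant, that is, invariant under
all automorphisms of `U` that fix `M` pointwise. -/
def Inv (φ : L.Formula (Fin n ⊕ Fin m)) (M : L.ElementarySubstructure U) :
    Set (GlobalType U φ) :=
  {p | ∀ σ : U ≃[L] U, (∀ c ∈ M, σ c = c) →
    ∀ b : Fin m → U, inst φ b ∈ p.carrier ↔ inst φ (σ ∘ b) ∈ p.carrier}

end Types

end LocalTypes

/-! The argument is in the style of Bourgain–Fremlin–Talagrand. A global φ-type is treated as the
function of b telling whether φ(x;b) belongs to it. Such a function is a pointwise limit of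
functions b ↦ φ(a;b) (`IsFinApprox`), and convergence of types is pointwise convergence. NIP enters
through `IsNIP.not_split`: if single functions of this kind could keep cutting all members of
growing finite families in two, an independent sequence would result.

Countable tightness: for the topology generated by the M-definable sets, which has a countable base,
an M-invariant type has a point of continuity on every nonempty set
(`IsNIP.exists_definable_const`). If no countable part of Z agreed with p on all k-tuples,
exhaustion would leave a nonempty F none of whose nonempty basic pieces is countably covered. An
ultrafilter limit of elements of Z that equals p on a countable dense part of F then equals p on a
whole piece of F, which is thus countably covered, a contradiction (`IsNIP.exists_countable_agree`).

Extracting a sequence: p is now an ultrafilter limit of a sequence from Z. If countably many sets of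
the ultrafilter witness agreement at every b, a diagonal choice converges. Otherwise exhaustion
gives a set on whose cells almost every term splits, against NIP
(`IsNIP.exists_seq_of_ultrafilter`). -/

namespace LocalTypes

variable {L : FirstOrder.Language.{u, v}} {U : Type w} [L.Structure U] {n m : ℕ}

/-! ### Saturation over countable parameter sets -/

section Saturation

/-- In a saturated structure, a family of sets definable over a countable set of parameters which
has the finite intersection property has nonempty intersection. -/
theorem IsSaturated.exists_mem_of_finite {κ : Cardinal.{w}} (hU : IsSaturated L U κ) (hκ : ℵ₀ < κ)
    {A : Set U} (hA : A.Countable) {k : ℕ} (S : Set (Set (Fin k → U)))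
    (hdef : ∀ s ∈ S, A.Definable L s)
    (hfin : ∀ t : Finset (Set (Fin k → U)), (t : Set (Set (Fin k → U))) ⊆ S →
      ∃ a, ∀ s ∈ t, a ∈ s) :
    ∃ a, ∀ s ∈ S, a ∈ s := by
  classical
  obtain ⟨a, ha⟩ := hU A ((hA.le_aleph0).trans_lt hκ) k
    {ψ | {a | ψ.Realize a} ∈ S} (by
      intro s hs
      obtain ⟨a, ha⟩ := hfin (s.image fun ψ => {a | ψ.Realize a}) (by
        intro x hx
        obtain ⟨ψ, hψ, rfl⟩ := Finset.mem_image.1 (Finset.mem_coe.1 hx)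
        exact hs hψ)
      exact ⟨a, fun ψ hψ => ha _ (Finset.mem_image_of_mem _ hψ)⟩)
  refine ⟨a, fun s hs => ?_⟩
  obtain ⟨ψ, rfl⟩ := hdef s hs
  exact ha ψ hs

/-- Variant of `IsSaturated.exists_mem_of_finite` for a family closed under intersection each
member of which meets a given definable set. -/
theorem IsSaturated.exists_mem_of_inter {κ : Cardinal.{w}} (hU : IsSaturated L U κ) (hκ : ℵ₀ < κ)
    {A : Set U} (hA : A.Countable) {k : ℕ} (S : Set (Set (Fin k → U))) (W : Set (Fin k → U))
    (hW : A.Definable L W) (hdef : ∀ s ∈ S, A.Definable L s) (huniv : Set.univ ∈ S)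
    (hinter : ∀ s ∈ S, ∀ t ∈ S, s ∩ t ∈ S) (hmeet : ∀ s ∈ S, (s ∩ W).Nonempty) :
    ∃ a ∈ W, ∀ s ∈ S, a ∈ s := by
  classical
  obtain ⟨a, ha⟩ := hU.exists_mem_of_finite hκ hA (insert W S)
    (by
      rintro s (rfl | hs)
      · exact hW
      · exact hdef s hs)
    (by
      intro t ht
      have key : ∃ s ∈ S, ∀ r ∈ t, s ∩ W ⊆ r := by
        induction t using Finset.induction_on with
        | empty => exact ⟨Set.univ, huniv, by simp⟩
        | insert r t _ ih =>
          obtain ⟨s, hs, hst⟩ := ih fun x hx => ht (by simp_all)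
          rcases ht (Finset.mem_coe.2 (Finset.mem_insert_self r t)) with rfl | hr
          · refine ⟨s, hs, fun x hx => ?_⟩
            rcases Finset.mem_insert.1 hx with rfl | hx
            · exact Set.inter_subset_right
            · exact hst x hx
          · refine ⟨r ∩ s, hinter r hr s hs, fun x hx => ?_⟩
            rcases Finset.mem_insert.1 hx with rfl | hx
            · exact fun y hy => hy.1.1
            · exact fun y hy => hst x hx ⟨hy.1.2, hy.2⟩
      obtain ⟨s, hs, hst⟩ := key
      obtain ⟨a, ha⟩ := hmeet s hs
      exact ⟨a, fun r hr => hst r hr ha⟩)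
  exact ⟨a, ha W (Set.mem_insert _ _), fun s hs => ha s (Set.mem_insert_of_mem _ hs)⟩

end Saturation

/-! ### Definable sets and conjugacy of tuples -/

section Definable

theorem definable_realize_right (φ : L.Formula (Fin n ⊕ Fin m)) (a : Fin n → U) :
    (Set.range a).Definable L {b : Fin m → U | φ.Realize (Sum.elim a b)} := by
  refine Set.definable_iff_exists_formula_sum.2
    ⟨φ.relabel (Sum.map (fun i => ⟨a i, Set.mem_range_self i⟩) id), ?_⟩
  ext b
  simp only [Set.mem_ofPred_eq, Language.Formula.realize_relabel]
  rw [iff_iff_eq]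
  congr 1
  funext i
  cases i <;> rfl

theorem definable_realize_left (φ : L.Formula (Fin n ⊕ Fin m)) (b : Fin m → U) :
    (Set.range b).Definable L {a : Fin n → U | φ.Realize (Sum.elim a b)} := by
  refine Set.definable_iff_exists_formula_sum.2
    ⟨φ.relabel (Sum.elim Sum.inr (fun i => Sum.inl ⟨b i, Set.mem_range_self i⟩)), ?_⟩
  ext a
  simp only [Set.mem_ofPred_eq, Language.Formula.realize_relabel]
  rw [iff_iff_eq]
  congr 1
  funext i
  cases i <;> rfl

theorem countable_setOf_definable [Countable L.Symbols] {A : Set U} (hA : A.Countable) (k : ℕ) :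
    {s : Set (Fin k → U) | A.Definable L s}.Countable := by
  have : Countable A := hA
  refine (Set.countable_range fun ψ : L[[A]].Formula (Fin k) => {a | ψ.Realize a}).mono ?_
  rintro s ⟨ψ, rfl⟩
  exact ⟨ψ, rfl⟩

/-- Tuples with the same type over a countable set are conjugate over it. -/
theorem IsStronglyHomogeneous.exists_equiv {κ : Cardinal.{w}} (hU : IsStronglyHomogeneous L U κ)
    (hκ : ℵ₀ < κ) {A : Set U} (hA : A.Countable) {b b' : Fin m → U}
    (h : ∀ s : Set (Fin m → U), A.Definable L s → b ∈ s → b' ∈ s) :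
    ∃ σ : U ≃[L] U, (∀ c ∈ A, σ c = c) ∧ σ ∘ b = b' := by
  have hform : ∀ ψ : L.Formula (A ⊕ Fin m),
      ψ.Realize (Sum.elim (↑) b) ↔ ψ.Realize (Sum.elim (↑) b') := by
    intro ψ
    have hd : A.Definable L {v : Fin m → U | ψ.Realize (Sum.elim (↑) v)} :=
      Set.definable_iff_exists_formula_sum.2 ⟨ψ, rfl⟩
    refine ⟨fun hb => h _ hd hb, fun hb' => ?_⟩
    by_contra hb
    exact h _ hd.compl hb hb'
  -- Entries of `b` may repeat or lie in `A`; the map to `b'` is well defined because equalities are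
  -- part of the type.
  have heq : ∀ i j : A ⊕ Fin m, (Sum.elim (↑) b i : U) = Sum.elim (↑) b j →
      (Sum.elim (↑) b' i : U) = Sum.elim (↑) b' j := by
    intro i j hij
    have := (hform ((Language.Term.var i).equal (Language.Term.var j))).1
      (by simpa [Language.Formula.realize_equal] using hij)
    simpa [Language.Formula.realize_equal] using this
  have hsurj : ∀ c : Set.range (Sum.elim (↑) b : A ⊕ Fin m → U),
      ∃ i : A ⊕ Fin m, Sum.elim (↑) b i = (c : U) := fun c => c.2
  choose g hg using hsurj
  have : Countable A := hA
  obtain ⟨σ, hσ⟩ := hU (Set.range (Sum.elim (↑) b : A ⊕ Fin m → U))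
    ((Set.countable_range _).le_aleph0.trans_lt hκ)
    (fun c => Sum.elim (↑) b' (g c)) (by
      intro ψ
      have := hform (ψ.relabel g)
      simp only [Language.Formula.realize_relabel] at this
      rwa [show Sum.elim (↑) b ∘ g = Subtype.val from funext hg] at this)
  have hσ' : ∀ i : A ⊕ Fin m, σ (Sum.elim (↑) b i) = Sum.elim (↑) b' i := by
    intro i
    have := hσ ⟨Sum.elim (↑) b i, Set.mem_range_self i⟩
    exact this.trans (heq _ _ (hg _))
  exact ⟨σ, fun c hc => hσ' (Sum.inl ⟨c, hc⟩), funext fun i => hσ' (Sum.inr i)⟩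

end Definable

/-! ### Pointwise limits of the functions b ↦ φ(a;b) -/

section Approximation

/-- `f` agrees on every finite set with a function `b ↦ φ(a;b)`. -/
def IsFinApprox (φ : L.Formula (Fin n ⊕ Fin m)) (f : (Fin m → U) → Prop) : Prop :=
  ∀ t : Finset (Fin m → U), ∃ a : Fin n → U, ∀ b ∈ t, (φ.Realize (Sum.elim a b) ↔ f b)

theorem isFinApprox_realize (φ : L.Formula (Fin n ⊕ Fin m)) (a : Fin n → U) :
    IsFinApprox φ fun b => φ.Realize (Sum.elim a b) :=
  fun _ => ⟨a, fun _ _ => Iff.rfl⟩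

/-- Saturation passes from finite to countable sets, so wherever only countably many points matter
an abstract limit can be replaced by an actual tuple. -/
theorem IsFinApprox.exists_realize {κ : Cardinal.{w}} (hU : IsSaturated L U κ) (hκ : ℵ₀ < κ)
    {φ : L.Formula (Fin n ⊕ Fin m)} {f : (Fin m → U) → Prop} (hf : IsFinApprox φ f)
    {B : Set (Fin m → U)} (hB : B.Countable) :
    ∃ a : Fin n → U, ∀ b ∈ B, (φ.Realize (Sum.elim a b) ↔ f b) := by
  classical
  obtain ⟨a, ha⟩ := hU.exists_mem_of_finite (k := n) hκ
    (A := ⋃ b ∈ B, Set.range b) (hB.biUnion fun b _ => Set.countable_range b)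
    ((fun b => {a | φ.Realize (Sum.elim a b) ↔ f b}) '' B)
    (by
      rintro _ ⟨b, hb, rfl⟩
      have h := (definable_realize_left φ b).mono (Set.subset_biUnion_of_mem (u := Set.range) hb)
      by_cases hfb : f b
      · simpa [hfb] using h
      · simpa [hfb, Set.compl_ofPred] using h.compl)
    (by
      intro t ht
      obtain ⟨s, hsB, rfl⟩ := Finset.subset_set_image_iff.1 ht
      obtain ⟨a, ha⟩ := hf s
      refine ⟨a, fun x hx => ?_⟩
      obtain ⟨b, hb, rfl⟩ := Finset.mem_image.1 hx
      exact ha b hb)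
  exact ⟨a, fun b hb => ha _ (Set.mem_image_of_mem _ hb)⟩

/-- On a finite set almost every `f i` already equals the limit. -/
theorem isFinApprox_ultrafilter {ι : Type*} {φ : L.Formula (Fin n ⊕ Fin m)}
    {f : ι → (Fin m → U) → Prop} (hf : ∀ i, IsFinApprox φ (f i)) (F : Ultrafilter ι) :
    IsFinApprox φ fun b => ∀ᶠ i in F, f i b := by
  intro t
  have h : ∀ᶠ i in F, ∀ b ∈ t, (f i b ↔ ∀ᶠ j in F, f j b) := by
    rw [Filter.eventually_all_finset]
    intro b _
    by_cases hb : ∀ᶠ j in F, f j b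
    · filter_upwards [hb] with i hi using ⟨fun _ => hb, fun _ => hi⟩
    · filter_upwards [Ultrafilter.eventually_not.2 hb] with i hi
        using ⟨fun h => absurd h hi, fun h => absurd h hb⟩
  obtain ⟨i, hi⟩ := h.exists
  obtain ⟨a, ha⟩ := hf i t
  exact ⟨a, fun b hb => (ha b hb).trans (hi b hb)⟩

end Approximation

/-! ### Splitting families and independence -/

section NIP

/-- By saturation, finite independence gives a parameter for every pattern on the whole sequence;
this also forces `a` to be injective, so its range is an infinite shattered set. -/
theorem IsNIP.not_exists_indep {κ : Cardinal.{w}} (hU : IsSaturated L U κ) (hκ : ℵ₀ < κ)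
    {φ : L.Formula (Fin n ⊕ Fin m)} (hφ : IsNIP U φ) (a : ℕ → Fin n → U)
    (ha : ∀ (k : ℕ) (η : ℕ → Prop), ∃ b : Fin m → U, ∀ i < k,
      (φ.Realize (Sum.elim (a i) b) ↔ η i)) : False := by
  classical
  have hex : ∀ η : ℕ → Prop, ∃ b : Fin m → U, ∀ i, (φ.Realize (Sum.elim (a i) b) ↔ η i) := by
    intro η
    obtain ⟨b, hb⟩ := hU.exists_mem_of_finite (k := m) hκ
      (A := ⋃ i, Set.range (a i)) (Set.countable_iUnion fun i => Set.countable_range (a i))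
      (Set.range fun i => {b | φ.Realize (Sum.elim (a i) b) ↔ η i})
      (by
        rintro _ ⟨i, rfl⟩
        have h := (definable_realize_right φ (a i)).mono
          (Set.subset_iUnion (fun i => Set.range (a i)) i)
        by_cases hi : η i
        · simpa [hi] using h
        · simpa [hi, Set.compl_ofPred] using h.compl)
      (by
        intro t ht
        rw [← Set.image_univ] at ht
        obtain ⟨s, -, rfl⟩ := Finset.subset_set_image_iff.1 ht
        obtain ⟨b, hb⟩ := ha (s.sup id + 1) η
        refine ⟨b, fun x hx => ?_⟩
        obtain ⟨i, hi, rfl⟩ := Finset.mem_image.1 hx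
        exact hb i (Nat.lt_succ_of_le (Finset.le_sup (f := id) hi)))
    exact ⟨b, fun i => hb _ (Set.mem_range_self i)⟩
  have hinj : Function.Injective a := by
    intro i j hij
    obtain ⟨b, hb⟩ := hex fun l => l = i
    exact ((hb j).1 (hij ▸ (hb i).2 rfl)).symm
  choose b hb using hex
  refine hφ ⟨Set.range a, Set.infinite_range_of_injective hinj, fun I => b fun i => a i ∈ I, ?_⟩
  rintro I - _ ⟨i, rfl⟩
  exact hb _ i

/-- If `φ` is NIP, there is no nonempty collection of nonempty sets every finite part of which can
be split by a single approximable function. -/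
theorem IsNIP.not_split {κ : Cardinal.{w}} (hU : IsSaturated L U κ) (hκ : ℵ₀ < κ)
    {φ : L.Formula (Fin n ⊕ Fin m)} (hφ : IsNIP U φ) (big : Set (Set (Fin m → U)))
    (hbig : big.Nonempty) (hne : ∀ V ∈ big, V.Nonempty)
    (hsplit : ∀ S : Finset (Set (Fin m → U)), (S : Set (Set (Fin m → U))) ⊆ big →
      ∃ f : (Fin m → U) → Prop, IsFinApprox φ f ∧
        ∀ V ∈ S, V ∩ {b | f b} ∈ big ∧ V ∩ {b | ¬ f b} ∈ big) : False := by
  classical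
  obtain ⟨V₀, hV₀⟩ := hbig
  let X := {S : Finset (Set (Fin m → U)) // (S : Set (Set (Fin m → U))) ⊆ big}
  have hX : ∀ S : X, ∃ f : (Fin m → U) → Prop, IsFinApprox φ f ∧
      ∀ V ∈ S.1, V ∩ {b | f b} ∈ big ∧ V ∩ {b | ¬ f b} ∈ big := fun S => hsplit S.1 S.2
  choose F hF hFS using hX
  -- All members are cut by the same function, so level k of the tree carries every sign pattern of
  -- the first k functions.
  let next : X → X := fun S =>
    ⟨(S.1.image fun V => V ∩ {b | F S b}) ∪ (S.1.image fun V => V ∩ {b | ¬ F S b}), by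
      intro W hW
      rcases Finset.mem_union.1 (Finset.mem_coe.1 hW) with hW | hW
      · obtain ⟨V, hV, rfl⟩ := Finset.mem_image.1 hW
        exact (hFS S V hV).1
      · obtain ⟨V, hV, rfl⟩ := Finset.mem_image.1 hW
        exact (hFS S V hV).2⟩
  let S : ℕ → X := fun k => next^[k] ⟨{V₀}, by simpa using hV₀⟩
  have hS : ∀ k, S (k + 1) = next (S k) := fun k => Function.iterate_succ_apply' _ _ _
  have htree : ∀ (k : ℕ) (η : ℕ → Prop), ∃ V ∈ (S k).1, ∀ b ∈ V, ∀ i < k, (F (S i) b ↔ η i) := by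
    intro k η
    induction k with
    | zero => exact ⟨V₀, by simp [S], by simp⟩
    | succ k ih =>
      obtain ⟨V, hV, hVb⟩ := ih
      by_cases hk : η k
      · refine ⟨V ∩ {b | F (S k) b}, ?_, ?_⟩
        · rw [hS]
          exact Finset.mem_union_left _ (Finset.mem_image_of_mem _ hV)
        · rintro b ⟨hb, hb'⟩ i hi
          rcases Nat.lt_succ_iff_lt_or_eq.1 hi with hi | rfl
          · exact hVb b hb i hi
          · exact ⟨fun _ => hk, fun _ => hb'⟩
      · refine ⟨V ∩ {b | ¬ F (S k) b}, ?_, ?_⟩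
        · rw [hS]
          exact Finset.mem_union_right _ (Finset.mem_image_of_mem (fun V => V ∩ {b | ¬ F (S k) b}) hV)
        · rintro b ⟨hb, hb'⟩ i hi
          rcases Nat.lt_succ_iff_lt_or_eq.1 hi with hi | rfl
          · exact hVb b hb i hi
          · exact ⟨fun h => absurd h hb', fun h => absurd h hk⟩
  -- Patterns are coded by finite sets to keep the set of chosen points countable, as
  -- `exists_realize` requires.
  have hpt : ∀ x : ℕ × Finset ℕ, ∃ b : Fin m → U, ∀ i < x.1, (F (S i) b ↔ i ∈ x.2) := by
    intro x
    obtain ⟨V, hV, hVb⟩ := htree x.1 fun i => i ∈ x.2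
    obtain ⟨b, hb⟩ := hne V ((S x.1).2 hV)
    exact ⟨b, hVb b hb⟩
  choose b hb using hpt
  have happ := fun i => (hF (S i)).exists_realize hU hκ (Set.countable_range b)
  choose a ha using happ
  refine hφ.not_exists_indep hU hκ a fun k η =>
    ⟨b (k, (Finset.range k).filter η), fun i hi => ?_⟩
  rw [ha i _ (Set.mem_range_self _), hb _ i hi]
  simp [hi]

end NIP

/-! ### Exhaustion by countably covered boxes -/

section Exhaustion

/-- Either countably many of the sets `R i` cover `α`, or there is a nonempty set `F` such that no
countably many of them cover the trace on `F` of a member of the countable family `box` that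
meets `F`. -/
theorem exists_countable_cover_or {α β ι : Type*} [Countable β] (box : β → Set α) (R : ι → Set α) :
    (∃ C : Set ι, C.Countable ∧ ∀ y, ∃ c ∈ C, y ∈ R c) ∨
    ∃ F : Set α, F.Nonempty ∧ ∀ x, (F ∩ box x).Nonempty → ∀ C : Set ι, C.Countable →
      ∃ y ∈ F ∩ box x, ∀ c ∈ C, y ∉ R c := by
  classical
  have h : ∀ x, ∃ C : Set ι, C.Countable ∧
      ((∃ C : Set ι, C.Countable ∧ ∀ y ∈ box x, ∃ c ∈ C, y ∈ R c) →
        ∀ y ∈ box x, ∃ c ∈ C, y ∈ R c) := by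
    intro x
    by_cases hx : ∃ C : Set ι, C.Countable ∧ ∀ y ∈ box x, ∃ c ∈ C, y ∈ R c
    · obtain ⟨C, hC, hCx⟩ := hx
      exact ⟨C, hC, fun _ => hCx⟩
    · exact ⟨∅, Set.countable_empty, fun h => absurd h hx⟩
  choose C hC hCx using h
  by_cases hcov : ∀ y, ∃ c ∈ ⋃ x, C x, y ∈ R c
  · exact Or.inl ⟨⋃ x, C x, Set.countable_iUnion hC, hcov⟩
  -- What remains outside the chosen covers of all countably coverable boxes. A countable cover of
  -- its trace on a box, together with those covers, would cover the box, so the trace was empty.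
  refine Or.inr ⟨{y | ∀ c ∈ ⋃ x, C x, y ∉ R c}, by simpa [Set.Nonempty] using hcov, ?_⟩
  rintro x ⟨y₀, hy₀, hy₀x⟩ D hD
  by_contra hcon
  push Not at hcon
  obtain ⟨c, hc, hyc⟩ := hCx x ⟨(⋃ x, C x) ∪ D, (Set.countable_iUnion hC).union hD, fun y hy => by
    by_cases hyF : ∀ c ∈ ⋃ x, C x, y ∉ R c
    · obtain ⟨c, hc, hyc⟩ := hcon y ⟨hyF, hy⟩
      exact ⟨c, Or.inr hc, hyc⟩
    · push Not at hyF
      obtain ⟨c, hc, hyc⟩ := hyF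
      exact ⟨c, Or.inl hc, hyc⟩⟩ y₀ hy₀x
  exact hy₀ c (Set.mem_iUnion_of_mem x hc) hyc

end Exhaustion

/-! ### Continuity points of invariant types and countable tightness -/

section Invariant

/-- `f` only depends on the type over `A` of its argument. -/
def IsTypeInvariant (L : FirstOrder.Language.{u, v}) [L.Structure U] (A : Set U)
    (f : (Fin m → U) → Prop) : Prop :=
  ∀ b b' : Fin m → U, (∀ s : Set (Fin m → U), A.Definable L s → b ∈ s → b' ∈ s) → (f b ↔ f b')

theorem isTypeInvariant_ultrafilter {ι : Type*} {A : Set U} {f : ι → (Fin m → U) → Prop}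
    (hf : ∀ i, IsTypeInvariant L A (f i)) (F : Ultrafilter ι) :
    IsTypeInvariant L A fun b => ∀ᶠ i in F, f i b :=
  fun b b' h => Filter.eventually_congr (Filter.Eventually.of_forall fun i => hf i b b' h)

variable {κ : Cardinal.{w}} {φ : L.Formula (Fin n ⊕ Fin m)} {A : Set U}

/-- If `φ` is NIP, an invariant approximable function is constant on a nonempty relatively open
part of every nonempty set, for the topology generated by the `A`-definable sets. -/
theorem IsNIP.exists_definable_const [Countable L.Symbols] (hφ : IsNIP U φ)
    (hU : IsSaturated L U κ) (hκ : ℵ₀ < κ) (hA : A.Countable) {f : (Fin m → U) → Prop}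
    (hf : IsFinApprox φ f) (hinv : IsTypeInvariant L A f) {E : Set (Fin m → U)}
    (hE : E.Nonempty) :
    ∃ s : Set (Fin m → U), A.Definable L s ∧ (E ∩ s).Nonempty ∧
      ∀ b ∈ E ∩ s, ∀ b' ∈ E ∩ s, (f b ↔ f b') := by
  classical
  by_contra hcon
  push Not at hcon
  let X := {s : Set (Fin m → U) // A.Definable L s ∧ (E ∩ s).Nonempty}
  have : Countable X :=
    ((countable_setOf_definable (L := L) hA m).mono fun s (hs : _ ∧ _) => hs.1 :
      {s : Set (Fin m → U) | A.Definable L s ∧ (E ∩ s).Nonempty}.Countable)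
  have hX : ∀ x : X, (∃ b ∈ E ∩ x.1, f b) ∧ ∃ b ∈ E ∩ x.1, ¬ f b := by
    rintro ⟨s, hs, hEs⟩
    obtain ⟨b, hb, b', hb', h⟩ := hcon s hs hEs
    rcases h with h | h
    · exact ⟨⟨b, hb, h.1⟩, ⟨b', hb', h.2⟩⟩
    · exact ⟨⟨b', hb', h.2⟩, ⟨b, hb, h.1⟩⟩
  choose d₁ hd₁ hfd₁ using fun x => (hX x).1
  choose d₀ hd₀ hfd₀ using fun x => (hX x).2
  -- A countable dense part of `E`; `f` takes both values on `D` inside every basic open set meeting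
  -- `E`.
  let D : Set (Fin m → U) := Set.range d₁ ∪ Set.range d₀
  have hDE : D ⊆ E := by
    rintro _ (⟨x, rfl⟩ | ⟨x, rfl⟩)
    · exact (hd₁ x).1
    · exact (hd₀ x).1
  have hDc : D.Countable := (Set.countable_range _).union (Set.countable_range _)
  have : Countable D := hDc
  let x₀ : X := ⟨Set.univ, Set.definable_univ, by simpa using hE⟩
  -- Sets definable over countably many parameters that realise the type over `A` of every point of
  -- `D`.
  let big : Set (Set (Fin m → U)) := {V | (∃ C : Set U, C.Countable ∧ C.Definable L V) ∧
    ∀ d : D, ∃ d' ∈ V, ∀ s : Set (Fin m → U), A.Definable L s → d.1 ∈ s → d' ∈ s}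
  refine hφ.not_split hU hκ big
    ⟨Set.univ, ⟨∅, Set.countable_empty, Set.definable_univ⟩, fun d => ⟨d, trivial, fun _ _ h => h⟩⟩
    (fun V hV => ?_) (fun S hS => ?_)
  · obtain ⟨d', hd', -⟩ := hV.2 ⟨d₁ x₀, Or.inl ⟨x₀, rfl⟩⟩
    exact ⟨d', hd'⟩
  choose w hwV hw using fun V : S => (hS V.2).2
  -- By invariance φ(a;·) takes the value `f e` at the chosen realisation of the type of `e`.
  -- Density of both values makes the type of each `d` finitely satisfiable on both sides of the
  -- cut, and saturation realises it there.
  obtain ⟨a, ha⟩ := hf.exists_realize hU hκ (B := Set.range fun z : S × D => w z.1 z.2)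
    (Set.countable_range _)
  have hsplit : ∀ V ∈ S, ∀ W : Set (Fin m → U), (Set.range a).Definable L W →
      (∀ x : X, ∃ e : D, e.1 ∈ x.1 ∧ ∀ V : S, w V e ∈ W) → V ∩ W ∈ big := by
    intro V hV W hW hmeet
    obtain ⟨C, hC, hCV⟩ := (hS hV).1
    have hC' : (C ∪ Set.range a).Countable := hC.union (Set.countable_range a)
    have hVW : (C ∪ Set.range a).Definable L (V ∩ W) :=
      (hCV.mono Set.subset_union_left).inter (hW.mono Set.subset_union_right)
    refine ⟨⟨_, hC', hVW⟩, fun d => ?_⟩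
    obtain ⟨d', hd', hd's⟩ := hU.exists_mem_of_inter hκ (hA.union hC')
      {s | A.Definable L s ∧ d.1 ∈ s} (V ∩ W) (hVW.mono Set.subset_union_right)
      (fun s hs => hs.1.mono Set.subset_union_left) ⟨Set.definable_univ, trivial⟩
      (fun s hs t ht => ⟨hs.1.inter ht.1, hs.2, ht.2⟩) (by
        rintro s ⟨hs, hds⟩
        obtain ⟨e, hes, he⟩ := hmeet ⟨s, hs, d, hDE d.2, hds⟩
        exact ⟨w ⟨V, hV⟩ e, hw _ _ s hs hes, hwV ⟨V, hV⟩ e, he _⟩)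
    exact ⟨d', hd', fun s hs hds => hd's s ⟨hs, hds⟩⟩
  have hfw : ∀ (V : S) (e : D), φ.Realize (Sum.elim a (w V e)) ↔ f e := fun V e =>
    (ha _ ⟨(V, e), rfl⟩).trans (hinv _ _ (hw V e)).symm
  refine ⟨_, isFinApprox_realize φ a, fun V hV => ⟨hsplit V hV _ (definable_realize_right φ a) ?_,
    hsplit V hV _ (definable_realize_right φ a).compl ?_⟩⟩
  · exact fun x => ⟨⟨d₁ x, Or.inl ⟨x, rfl⟩⟩, (hd₁ x).2, fun V => (hfw V _).2 (hfd₁ x)⟩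
  · exact fun x => ⟨⟨d₀ x, Or.inr ⟨x, rfl⟩⟩, (hd₀ x).2, fun V h => hfd₀ x ((hfw V _).1 h)⟩

/-- The product of a finite family of definable sets. -/
def definableBox (L : FirstOrder.Language.{u, v}) [L.Structure U] {A : Set U} {k : ℕ}
    (x : Fin k → {s : Set (Fin m → U) // A.Definable L s}) : Set (Fin k → Fin m → U) :=
  {y | ∀ i, y i ∈ (x i).1}

/-- Coordinates are treated one at a time: the one-variable result is applied to the projection of
the current piece, and the box shrinks in that coordinate. -/
theorem IsNIP.exists_definableBox_const [Countable L.Symbols] (hφ : IsNIP U φ)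
    (hU : IsSaturated L U κ) (hκ : ℵ₀ < κ) (hA : A.Countable) {f : (Fin m → U) → Prop}
    (hf : IsFinApprox φ f) (hinv : IsTypeInvariant L A f) {k : ℕ} {F : Set (Fin k → Fin m → U)}
    (hF : F.Nonempty) :
    ∃ x : Fin k → {s : Set (Fin m → U) // A.Definable L s}, (F ∩ definableBox L x).Nonempty ∧
      ∀ i, ∀ y ∈ F ∩ definableBox L x, ∀ y' ∈ F ∩ definableBox L x, (f (y i) ↔ f (y' i)) := by
  classical
  suffices h : ∀ t : Finset (Fin k), ∃ x : Fin k → {s : Set (Fin m → U) // A.Definable L s},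
      (F ∩ definableBox L x).Nonempty ∧ ∀ i ∈ t, ∀ y ∈ F ∩ definableBox L x,
        ∀ y' ∈ F ∩ definableBox L x, (f (y i) ↔ f (y' i)) by
    obtain ⟨x, hx, hxf⟩ := h Finset.univ
    exact ⟨x, hx, fun i => hxf i (Finset.mem_univ i)⟩
  intro t
  induction t using Finset.induction_on with
  | empty =>
    obtain ⟨y, hy⟩ := hF
    exact ⟨fun _ => ⟨Set.univ, Set.definable_univ⟩, ⟨y, hy, fun _ => trivial⟩, by simp⟩
  | insert j t _ ih =>
    obtain ⟨x, hx, hxf⟩ := ih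
    obtain ⟨s, hs, ⟨_, ⟨y, hy, rfl⟩, hys⟩, hsf⟩ :=
      hφ.exists_definable_const hU hκ hA hf hinv (hx.image fun y => y j)
    let x' := Function.update x j ⟨(x j).1 ∩ s, (x j).2.inter hs⟩
    have hx' : ∀ y, y ∈ definableBox L x' ↔ y ∈ definableBox L x ∧ y j ∈ s := by
      intro y
      constructor
      · intro h
        refine ⟨fun i => ?_, ?_⟩
        · by_cases hij : i = j
          · subst hij
            have := h i
            simp only [x', Function.update_self] at this
            exact this.1
          · simpa [x', Function.update_of_ne hij] using h i
        · have := h j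
          simp only [x', Function.update_self] at this
          exact this.2
      · rintro ⟨h, hj⟩ i
        by_cases hij : i = j
        · subst hij
          simp only [x', Function.update_self]
          exact ⟨h i, hj⟩
        · simpa [x', Function.update_of_ne hij] using h i
    refine ⟨x', ⟨y, hy.1, (hx' y).2 ⟨hy.2, hys⟩⟩, fun i hi z hz z' hz' => ?_⟩
    have hz1 := (hx' z).1 hz.2
    have hz2 := (hx' z').1 hz'.2
    rcases Finset.mem_insert.1 hi with rfl | hi
    · exact hsf _ ⟨⟨z, ⟨hz.1, hz1.1⟩, rfl⟩, hz1.2⟩ _ ⟨⟨z', ⟨hz'.1, hz2.1⟩, rfl⟩, hz2.2⟩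
    · exact hxf i hi z ⟨hz.1, hz1.1⟩ z' ⟨hz'.1, hz2.1⟩

/-- If `φ` is NIP and `p` is in the pointwise closure of a set `Z` of invariant functions, then
countably many elements of `Z` suffice to approximate `p` on all `k`-element sets. -/
theorem IsNIP.exists_countable_agree [Countable L.Symbols] [Nonempty U] (hφ : IsNIP U φ)
    (hU : IsSaturated L U κ) (hκ : ℵ₀ < κ) (hA : A.Countable) {ι : Type*}
    {f : ι → (Fin m → U) → Prop} {p : (Fin m → U) → Prop}
    (hf : ∀ i, IsFinApprox φ (f i)) (hfA : ∀ i, IsTypeInvariant L A (f i))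
    (hp : IsFinApprox φ p) (hpA : IsTypeInvariant L A p)
    (hcl : ∀ t : Finset (Fin m → U), ∃ i, ∀ b ∈ t, (f i b ↔ p b)) (k : ℕ) :
    ∃ C : Set ι, C.Countable ∧ ∀ y : Fin k → Fin m → U, ∃ c ∈ C, ∀ j, (f c (y j) ↔ p (y j)) := by
  classical
  have : Countable {s : Set (Fin m → U) // A.Definable L s} :=
    countable_setOf_definable (L := L) hA m
  rcases exists_countable_cover_or
    (definableBox L : (Fin k → {s : Set (Fin m → U) // A.Definable L s}) → _)
    (fun i => {y | ∀ j, (f i (y j) ↔ p (y j))}) with h | ⟨F, hF, hFbox⟩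
  · exact h
  exfalso
  let X := {x : Fin k → {s : Set (Fin m → U) // A.Definable L s} //
    (F ∩ definableBox L x).Nonempty}
  have hX : ∀ x : X, (F ∩ definableBox L x.1).Nonempty := fun x => x.2
  choose d hd using hX
  obtain ⟨e, he⟩ := Set.countable_iff_exists_subset_range.1
    (Set.countable_range fun z : X × Fin k => d z.1 z.2)
  choose g hg using fun l : ℕ => hcl ((Finset.range (l + 1)).image e)
  let h : (Fin m → U) → Prop := fun b => ∀ᶠ l in (Filter.hyperfilter ℕ : Filter ℕ), f (g l) b
  have hhp : ∀ x j, h (d x j) ↔ p (d x j) := by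
    intro x j
    obtain ⟨l₀, hl₀⟩ := he ⟨(x, j), rfl⟩
    have hev : ∀ᶠ l in (Filter.hyperfilter ℕ : Filter ℕ), (f (g l) (d x j) ↔ p (d x j)) := by
      refine Nat.hyperfilter_le_atTop ?_
      filter_upwards [Filter.eventually_ge_atTop l₀] with l hl
      refine hg l _ (Finset.mem_image.2 ⟨l₀, Finset.mem_range.2 (Nat.lt_succ_of_le hl), hl₀⟩)
    exact (Filter.eventually_congr hev).trans Filter.eventually_const
  -- Shrink to one box on which both `p` and the limit `h` are constant in each coordinate. They
  -- agree at its chosen point `d`, hence at every point of `F` in the box.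
  obtain ⟨x₁, hx₁, hx₁p⟩ := hφ.exists_definableBox_const hU hκ hA hp hpA hF
  obtain ⟨x₂, hx₂, hx₂h⟩ := hφ.exists_definableBox_const hU hκ hA
    (isFinApprox_ultrafilter (fun l => hf (g l)) (Filter.hyperfilter ℕ))
    (isTypeInvariant_ultrafilter (fun l => hfA (g l)) (Filter.hyperfilter ℕ)) hx₁
  let x₃ : Fin k → {s : Set (Fin m → U) // A.Definable L s} :=
    fun i => ⟨(x₁ i).1 ∩ (x₂ i).1, (x₁ i).2.inter (x₂ i).2⟩
  have hx₃ : definableBox L x₃ = definableBox L x₁ ∩ definableBox L x₂ := by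
    ext y
    exact ⟨fun h => ⟨fun i => (h i).1, fun i => (h i).2⟩, fun h i => ⟨h.1 i, h.2 i⟩⟩
  rw [Set.inter_assoc, ← hx₃] at hx₂ hx₂h
  have hx₃₁ : ∀ y ∈ F ∩ definableBox L x₃, y ∈ F ∩ definableBox L x₁ :=
    fun y hy => ⟨hy.1, (hx₃.subset hy.2).1⟩
  obtain ⟨y, hy, hyC⟩ := hFbox x₃ hx₂ (Set.range g) (Set.countable_range g)
  have hev : ∀ᶠ l in (Filter.hyperfilter ℕ : Filter ℕ), ∀ j, (f (g l) (y j) ↔ p (y j)) := by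
    rw [Filter.eventually_all]
    intro j
    have hyp : h (y j) ↔ p (y j) :=
      (hx₂h j y hy _ (hd ⟨x₃, hx₂⟩)).trans ((hhp _ j).trans
        (hx₁p j _ (hx₃₁ _ (hd ⟨x₃, hx₂⟩)) _ (hx₃₁ y hy)))
    by_cases hpy : p (y j)
    · filter_upwards [hyp.2 hpy] with l hl using ⟨fun _ => hpy, fun _ => hl⟩
    · filter_upwards [Ultrafilter.eventually_not.2 fun hh => hpy (hyp.1 hh)] with l hl
        using ⟨fun hh => absurd hh hl, fun hh => absurd hh hpy⟩
  obtain ⟨l, hl⟩ := hev.exists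
  exact hyC (g l) ⟨l, rfl⟩ hl

end Invariant

/-! ### From an ultrafilter limit to a sequence -/

section Sequence

variable {κ : Cardinal.{w}} {φ : L.Formula (Fin n ⊕ Fin m)}

/-- If `φ` is NIP, a cluster point of a sequence of approximable functions is the pointwise limit
of a reindexing of the sequence. -/
theorem IsNIP.exists_seq_of_ultrafilter (hφ : IsNIP U φ)
    (hU : IsSaturated L U κ) (hκ : ℵ₀ < κ) {q : ℕ → (Fin m → U) → Prop} {p : (Fin m → U) → Prop}
    (hq : ∀ l, IsFinApprox φ (q l)) (F : Ultrafilter ℕ)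
    (hF : ∀ b, ∀ᶠ l in F, (q l b ↔ p b)) :
    ∃ r : ℕ → ℕ, ∀ b, ∀ᶠ l in Filter.atTop, (q (r l) b ↔ p b) := by
  classical
  let box : Finset ℕ × Finset ℕ × Bool → Set (Fin m → U) := fun x =>
    {b | (∀ l ∈ x.1, q l b) ∧ (∀ l ∈ x.2.1, ¬ q l b) ∧ (p b ↔ x.2.2 = true)}
  rcases exists_countable_cover_or box
    (fun B : {B : Set ℕ // B ∈ F} => {b | ∀ l ∈ B.1, (q l b ↔ p b)}) with
    ⟨C, hC, hCcov⟩ | ⟨E, ⟨b₀, hb₀⟩, hE⟩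
  · have : Nonempty {B : Set ℕ // B ∈ F} := ⟨⟨Set.univ, Filter.univ_mem⟩⟩
    obtain ⟨e, he⟩ := Set.countable_iff_exists_subset_range.1 hC
    -- Diagonal choice: `r k` lies in the first k + 1 witnessing sets. Convergence does not need `r`
    -- to be increasing.
    have hr : ∀ k : ℕ, ∃ l, ∀ j ∈ Finset.range (k + 1), l ∈ (e j).1 := by
      intro k
      have : ∀ᶠ l in F, ∀ j ∈ Finset.range (k + 1), l ∈ (e j).1 := by
        rw [Filter.eventually_all_finset]
        exact fun j _ => (e j).2
      exact this.exists
    choose r hr using hr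
    refine ⟨r, fun b => ?_⟩
    obtain ⟨B, hB, hBb⟩ := hCcov b
    obtain ⟨j, rfl⟩ := he hB
    filter_upwards [Filter.eventually_ge_atTop j] with k hk
    exact hBb _ (hr k j (Finset.mem_range.2 (Nat.lt_succ_of_le hk)))
  exfalso
  obtain ⟨c, hc⟩ : ∃ c : Bool, p b₀ ↔ c = true := ⟨decide (p b₀), by simp⟩
  let cell : Finset ℕ × Finset ℕ → Set (Fin m → U) := fun x =>
    {b | (∀ l ∈ x.1, q l b) ∧ (∀ l ∈ x.2, ¬ q l b)}
  let big : Set (Set (Fin m → U)) := {V | ∃ x : Finset ℕ × Finset ℕ, V = cell x ∧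
    ∃ b ∈ E ∩ V, (p b ↔ c = true)}
  refine hφ.not_split hU hκ big ⟨cell (∅, ∅), _, rfl, b₀, ⟨hb₀, by simp [cell]⟩, hc⟩
    (fun V ⟨_, _, b, hb, _⟩ => ⟨b, hb.2⟩) (fun S hS => ?_)
  have hev : ∀ᶠ l in F, ∀ V ∈ S, (∃ b ∈ E ∩ V, (p b ↔ c = true) ∧ q l b) ∧
      ∃ b ∈ E ∩ V, (p b ↔ c = true) ∧ ¬ q l b := by
    rw [Filter.eventually_all_finset]
    intro V hV
    obtain ⟨x, rfl, b, hb, hbc⟩ := hS hV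
    -- Otherwise the set of l for which `q l` equals `p` throughout this piece is in `F`, and that
    -- one set covers the piece. With `hF b`, both values then occur for almost every l, since `p`
    -- has the constant value `c` here.
    have hne : ∀ᶠ l in F, ∃ z ∈ E ∩ cell x, (p z ↔ c = true) ∧ ¬ (q l z ↔ p z) := by
      by_contra hcon
      rw [← Ultrafilter.eventually_not] at hcon
      obtain ⟨z, ⟨hzE, hz1, hz2, hz3⟩, hzC⟩ := hE (x.1, x.2, c) ⟨b, hb.1, hb.2.1, hb.2.2, hbc⟩
        {⟨_, hcon⟩} (Set.countable_singleton _)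
      refine hzC _ rfl fun l hl => ?_
      by_contra hlz
      exact hl ⟨z, ⟨hzE, hz1, hz2⟩, hz3, hlz⟩
    filter_upwards [hF b, hne] with l hl ⟨z, hz, hzc, hzl⟩
    by_cases hlb : q l b
    · exact ⟨⟨b, hb, hbc, hlb⟩, ⟨z, hz, hzc, fun h => hzl (by tauto)⟩⟩
    · refine ⟨⟨z, hz, hzc, ?_⟩, ⟨b, hb, hbc, hlb⟩⟩
      by_contra h
      exact hzl (by tauto)
  obtain ⟨l, hl⟩ := hev.exists
  refine ⟨q l, hq l, fun V hV => ?_⟩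
  obtain ⟨⟨b, hb, hbc, hbl⟩, ⟨b', hb', hbc', hbl'⟩⟩ := hl V hV
  obtain ⟨x, rfl, -⟩ := hS hV
  constructor
  · refine ⟨(insert l x.1, x.2), ?_, b, ⟨hb.1, hb.2, hbl⟩, hbc⟩
    ext z
    simp only [cell, Set.mem_inter_iff, Set.mem_ofPred_eq, Finset.forall_mem_insert]
    tauto
  · refine ⟨(x.1, insert l x.2), ?_, b', ⟨hb'.1, hb'.2, hbl'⟩, hbc'⟩
    ext z
    simp only [cell, Set.mem_inter_iff, Set.mem_ofPred_eq, Finset.forall_mem_insert]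
    tauto

end Sequence

/-! ### Global types as functions -/

section GlobalType

variable {φ : L.Formula (Fin n ⊕ Fin m)}

theorem GlobalType.not_mem_iff (q : GlobalType U φ) (b : Fin m → U) :
    (inst φ b).not ∈ q.carrier ↔ inst φ b ∉ q.carrier := by
  classical
  refine ⟨fun h h' => ?_, fun h => (q.complete b).resolve_left h⟩
  obtain ⟨a, ha⟩ := q.consistent {inst φ b, (inst φ b).not} (by
    intro ψ hψ
    rcases Finset.mem_insert.1 (Finset.mem_coe.1 hψ) with rfl | hψ
    · exact h'
    · rwa [Finset.mem_singleton.1 hψ])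
  have h2 := ha (inst φ b).not (by simp)
  rw [Language.Formula.realize_not] at h2
  exact h2 (ha _ (by simp))

theorem GlobalType.isFinApprox (q : GlobalType U φ) :
    IsFinApprox φ fun b => inst φ b ∈ q.carrier := by
  classical
  intro t
  obtain ⟨a, ha⟩ := q.consistent
    (t.image fun b => if inst φ b ∈ q.carrier then inst φ b else (inst φ b).not) (by
      intro ψ hψ
      obtain ⟨b, -, rfl⟩ := Finset.mem_image.1 (Finset.mem_coe.1 hψ)
      split_ifs with h
      · exact h
      · exact (q.not_mem_iff b).2 h)
  refine ⟨a, fun b hb => ?_⟩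
  have h := ha _ (Finset.mem_image_of_mem _ hb)
  rw [← realize_inst]
  split_ifs at h with hb
  · exact ⟨fun _ => hb, fun _ => h⟩
  · rw [Language.Formula.realize_not] at h
    exact ⟨fun h' => absurd h' h, fun h' => absurd h' hb⟩

theorem GlobalType.tendsto_iff {ι : Type*} {F : Filter ι} {q : ι → GlobalType U φ}
    {p : GlobalType U φ} :
    Filter.Tendsto q F (𝓝 p) ↔
      ∀ b, ∀ᶠ i in F, (inst φ b ∈ (q i).carrier ↔ inst φ b ∈ p.carrier) := by
  refine TopologicalSpace.tendsto_nhds_generateFrom_iff.trans ⟨fun h b => ?_, fun h s hs hp => ?_⟩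
  · by_cases hb : inst φ b ∈ p.carrier
    · filter_upwards [h _ ⟨b, Or.inl rfl⟩ hb] with i hi using ⟨fun _ => hb, fun _ => hi⟩
    · filter_upwards [h _ ⟨b, Or.inr rfl⟩ ((p.not_mem_iff b).2 hb)] with i hi
        using ⟨fun h' => absurd h' (((q i).not_mem_iff b).1 hi), fun h' => absurd h' hb⟩
  · obtain ⟨b, rfl | rfl⟩ := hs
    · filter_upwards [h b] with i hi using hi.2 hp
    · filter_upwards [h b] with i hi
      exact ((q i).not_mem_iff b).2 fun h' => (p.not_mem_iff b).1 hp (hi.1 h')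

theorem GlobalType.exists_agree_of_mem_closure {Z : Set (GlobalType U φ)} {p : GlobalType U φ}
    (hp : p ∈ closure Z) (t : Finset (Fin m → U)) :
    ∃ q ∈ Z, ∀ b ∈ t, (inst φ b ∈ q.carrier ↔ inst φ b ∈ p.carrier) := by
  have h := GlobalType.tendsto_iff.1 (Filter.tendsto_id (x := 𝓝 p))
  have ht := (Filter.eventually_all_finset t).2 fun b _ => h b
  obtain ⟨q, hq, hqZ⟩ := mem_closure_iff_nhds.1 hp _ ht
  exact ⟨q, hqZ, hq⟩

/-- Each invariance condition compares only two instances, so it passes to pointwise limits. -/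
theorem isClosed_inv (M : L.ElementarySubstructure U) {p : GlobalType U φ}
    (hp : p ∈ closure (Inv φ M)) : p ∈ Inv φ M := by
  classical
  intro σ hσ b
  obtain ⟨q, hq, hqp⟩ := GlobalType.exists_agree_of_mem_closure hp {b, σ ∘ b}
  rw [← hqp b (by simp), ← hqp (σ ∘ b) (by simp)]
  exact hq σ hσ b

theorem isTypeInvariant_of_mem_inv {κ : Cardinal.{w}} (hU : IsStronglyHomogeneous L U κ)
    (hκ : ℵ₀ < κ) (M : L.ElementarySubstructure U) [Countable M] {q : GlobalType U φ}
    (hq : q ∈ Inv φ M) :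
    IsTypeInvariant L (M : Set U) fun b => inst φ b ∈ q.carrier := by
  intro b b' h
  obtain ⟨σ, hσ, rfl⟩ := hU.exists_equiv hκ (A := (M : Set U)) (Set.to_countable _) h
  exact hq σ hσ b

end GlobalType

end LocalTypes

/-! ### The main theorem -/

open LocalTypes in
theorem mainTheorem3 {L : FirstOrder.Language.{u, v}} [Countable L.Symbols]
    (T : L.Theory)
    (U : Type w) [L.Structure U] [Nonempty U] [T.Model U]
    (κ : Cardinal.{w}) (hκ : ℵ₀ < κ) (hU : LocalTypes.IsMonster L U κ)
    (M : L.ElementarySubstructure U) [Countable M]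
    {n m : ℕ} (φ : L.Formula (Fin n ⊕ Fin m)) (hφ : LocalTypes.IsNIP U φ)
    (Z : Set (LocalTypes.GlobalType U φ)) (hZ : Z ⊆ LocalTypes.Inv φ M)
    (p : LocalTypes.GlobalType U φ) (hp : p ∈ closure Z) :
    ∃ q : ℕ → LocalTypes.GlobalType U φ,
      (∀ k, q k ∈ Z) ∧ Filter.Tendsto q Filter.atTop (𝓝 p) := by
  classical
  have hpInv := isClosed_inv M (closure_mono hZ hp)
  have hcl : ∀ t : Finset (Fin m → U), ∃ q : Z, ∀ b ∈ t,
      (inst φ b ∈ q.1.carrier ↔ inst φ b ∈ p.carrier) := by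
    intro t
    obtain ⟨q, hq, h⟩ := GlobalType.exists_agree_of_mem_closure hp t
    exact ⟨⟨q, hq⟩, h⟩
  have hM : (M : Set U).Countable := Set.to_countable _
  choose C hC hCp using hφ.exists_countable_agree hU.saturated hκ hM
    (fun q : Z => q.1.isFinApprox)
    (fun q : Z => isTypeInvariant_of_mem_inv hU.homogeneous hκ M (hZ q.2))
    p.isFinApprox (isTypeInvariant_of_mem_inv hU.homogeneous hκ M hpInv) hcl
  have : Nonempty Z := ⟨(hcl ∅).choose⟩
  obtain ⟨e, he⟩ := Set.countable_iff_exists_subset_range.1 (Set.countable_iUnion hC)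
  -- The filter of agreement with `p` on finite sets. It is proper because `e` enumerates a set
  -- containing each `C k`, and a finite set `t` is handled by k = `t.card`.
  let G : Filter ℕ := ⨅ t : Finset (Fin m → U), Filter.principal
    {l | ∀ b ∈ t, (inst φ b ∈ (e l).1.carrier ↔ inst φ b ∈ p.carrier)}
  have : G.NeBot := by
    refine Filter.iInf_neBot_of_directed' (fun t t' => ⟨t ∪ t', ?_, ?_⟩) fun t => ?_
    · exact Filter.principal_mono.2 fun l hl b hb => hl b (Finset.mem_union_left _ hb)
    · exact Filter.principal_mono.2 fun l hl b hb => hl b (Finset.mem_union_right _ hb)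
    · obtain ⟨c, hc, hct⟩ := hCp t.card fun j => (t.equivFin.symm j).1
      obtain ⟨l, rfl⟩ := he (Set.mem_iUnion_of_mem _ hc)
      refine Filter.principal_neBot_iff.2 ⟨l, fun b hb => ?_⟩
      simpa using hct (t.equivFin ⟨b, hb⟩)
  have hF : ∀ b, ∀ᶠ l in Ultrafilter.of G,
      (inst φ b ∈ (e l).1.carrier ↔ inst φ b ∈ p.carrier) := by
    intro b
    refine Ultrafilter.of_le G (Filter.mem_iInf_of_mem {b} ?_)
    simp
  obtain ⟨r, hr⟩ := hφ.exists_seq_of_ultrafilter hU.saturated hκ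
    (fun l => (e l).1.isFinApprox) _ hF
  exact ⟨fun k => (e (r k)).1, fun k => (e (r k)).2, GlobalType.tendsto_iff.2 hr⟩
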